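/- Let $1\le r\le n$ and let $A\in\mathbb{C}[\partial_1,\dots,\partial_n]^{\ell\times k}$ be a matrix all of whose entries are homogeneous polynomials of the same degree $d$ (zero entries allowed). It acts on $k$-tuples of distributions $\phi\in\mathcal{D}'(\mathbb{R}^n,\mathbb{C}^k)$ by $\partial_s=\partial/\partial x_s$; $\phi$ is a solution of $A$ if $A\bullet\phi=0$. For $y\in\mathbb{R}^n$ let $A(y)\in\mathbb{C}^{\ell\times k}$ be the matrix obtained by substituting $y$ for $\partial$. The level $r$ real obstruction cone is $$\mathcal{O}^r_{A,\mathbb{R}}\;=\;\bigcap_{\sigma\in\mathrm{Gr}_{\mathbb{R}}(r,n)}\ \bigcup_{y\in\sigma\setminus\{0\}}\ker A(y)\ \subseteq\ \mathbb{C}^k ,$$ where $\mathrm{Gr}_{\mathbb{R}}(r,n)$ is the set of $r$-dimensional linear subspaces of $\mathbb{R}^n$ and the kernels are taken over $\mathbb{C}$. A wave pair for $A$ is a pair $(v,\pi)$ with $v\in\mathbb{C}^k$ and $\pi\subseteq\mathbb{R}^n$ a linear subspace such that $A(\xi)v=0$ for all $\xi\in\pi$. A wave solution of $A$ is a distribution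 that lies, for some wave pair $(v,\pi)$, in the closure in $\mathcal{D}'(\mathbb{R}^n,\mathbb{C}^k)$ of the set of finite sums $\sum_j\lambda_j\exp(i\,\xi_j\cdot x)\,v$ with $\lambda_j\in\mathbb{C}$ and $\xi_j\in\pi$. For every $u\in\mathbb{C}^k$ the following are equivalent: 1. $u\in\mathcal{O}^r_{A,\mathbb{R}}$; 2. for every matrix $S\in\mathbb{R}^{r\times n}$ of rank $r$ there is a bounded nonconstant $\delta$ on $\mathbb{R}^r$ such that $x\mapsto\delta(Sx)\cdot u$ is a wave solution of $A$; 3. for every matrix $S\in\mathbb{R}^{r\times n}$ of rank $r$ there is a bounded nonconstant $\delta$ on $\mathbb{R}^r$ such that $x\mapsto\delta(Sx)\cdot u$ is a solution of $A$. Here "bounded" means $\delta\in L^\infty(\mathbb{R}^r,\mathbb{C})$, "nonconstant" means not almost everywhere equal to a constant, and $\delta(Sx)\cdot u$ is regarded as a distribution. -/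

import Mathlib

open MeasureTheory
open scoped Distributions Matrix LineDeriv

noncomputable section

namespace WavePDE

/-- Real Euclidean space `ℝⁿ`. -/
abbrev E (n : ℕ) := EuclideanSpace ℝ (Fin n)

/-- The space `𝓓'(ℝⁿ, ℂ)` of complex-valued distributions on all of `ℝⁿ`. -/
abbrev Distr (n : ℕ) := 𝓓'((⊤ : TopologicalSpace.Opens (E n)), ℂ)

/-- The regular distribution `f ↦ ∫ f(x) g(x) dx` of a locally integrable function `g`. -/
def ofFun {n : ℕ} (g : E n → ℂ) : Distr n :=
  ContinuousLinearMap.toUniformConvergenceCLM (RingHom.id ℝ) ℂ {s | IsCompact s}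
    (TestFunction.integralAgainstBilinCLM (ContinuousLinearMap.lsmul ℝ ℝ) volume g)

/-- The defining formula of a regular distribution. -/
theorem ofFun_apply {n : ℕ} {g : E n → ℂ} (hg : LocallyIntegrable g volume)
    (f : 𝓓((⊤ : TopologicalSpace.Opens (E n)), ℝ)) :
    ofFun g f = ∫ x, f x • g x :=
  TestFunction.integralAgainstBilinCLM_eq_integral (hg.locallyIntegrableOn _)

/-- The partial derivative `∂ᵢ` on distributions. -/
def partialD {n : ℕ} (i : Fin n) : Distr n →L[ℝ] Distr n :=
  LineDeriv.lineDerivOpCLM ℝ (Distr n) (EuclideanSpace.single i (1 : ℝ))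

/-- The iterated partial derivative `∂^m = ∂₁^{m₁} ⋯ ∂ₙ^{mₙ}` on distributions. -/
def monomialD {n : ℕ} (m : Fin n →₀ ℕ) : Distr n →L[ℝ] Distr n :=
  ((List.finRange n).map fun i => partialD i ^ m i).prod

/-- The action `p • T` of a polynomial `p ∈ ℂ[∂₁, …, ∂ₙ]` on a distribution `T`. -/
def polyD {n : ℕ} (p : MvPolynomial (Fin n) ℂ) (T : Distr n) : Distr n :=
  ∑ m ∈ p.support, p.coeff m • monomialD m T

variable {n k l : ℕ}

/-- `φ : ℝⁿ → ℂᵏ`, a `k`-tuple of distributions, is a solution of the PDE `A • φ = 0`. -/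
def IsSolution (A : Matrix (Fin l) (Fin k) (MvPolynomial (Fin n) ℂ)) (φ : Fin k → Distr n) : Prop :=
  ∀ i, ∑ j, polyD (A i j) (φ j) = 0

/-- The complex matrix `A(y)` obtained from `A` by substituting the real vector `y` for `∂`. -/
def symbol (A : Matrix (Fin l) (Fin k) (MvPolynomial (Fin n) ℂ)) (y : E n) :
    Matrix (Fin l) (Fin k) ℂ :=
  A.map (MvPolynomial.eval fun i => (y i : ℂ))

/-- The real obstruction cone of level `r`: the intersection, over the `r`-dimensional real
subspaces `σ` of `ℝⁿ`, of the union, over `y ∈ σ ∖ {0}`, of the complex kernels of `A(y)`. -/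
def obstructionCone (A : Matrix (Fin l) (Fin k) (MvPolynomial (Fin n) ℂ)) (r : ℕ) :
    Set (Fin k → ℂ) :=
  ⋂ (σ : Submodule ℝ (E n)) (_ : Module.finrank ℝ σ = r),
    ⋃ y ∈ (σ : Set (E n)) \ {0}, {u | symbol A y *ᵥ u = 0}

/-- The `ℂᵏ`-valued distribution `x ↦ g(x) · u` for a scalar function `g` and `u ∈ ℂᵏ`. -/
def waveOfFun (g : E n → ℂ) (u : Fin k → ℂ) : Fin k → Distr n :=
  fun j => u j • ofFun g

/-- The simple wave `x ↦ exp(i ξ·x) · u`. -/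
def simpleWave (ξ : E n) (u : Fin k → ℂ) : Fin k → Distr n :=
  waveOfFun (fun x => Complex.exp (Complex.I * ((inner ℝ ξ x : ℝ) : ℂ))) u

/-- `(u, π)` is a wave pair for `A`: `A(ξ) u = 0` for all `ξ ∈ π`. -/
def IsWavePair (A : Matrix (Fin l) (Fin k) (MvPolynomial (Fin n) ℂ)) (u : Fin k → ℂ)
    (π : Submodule ℝ (E n)) : Prop :=
  ∀ ξ ∈ π, symbol A ξ *ᵥ u = 0

/-- The classical waves with amplitude `u` and frequencies in `π`: the finite superpositions
`∑ λⱼ exp(i ξⱼ·x) · u` with `λⱼ ∈ ℂ` and `ξⱼ ∈ π`. -/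
def classicalWaves (u : Fin k → ℂ) (π : Submodule ℝ (E n)) : Submodule ℂ (Fin k → Distr n) :=
  Submodule.span ℂ ((fun ξ => simpleWave ξ u) '' (π : Set (E n)))

/-- `φ` is a wave solution of `A`: it lies in the closure, in the space of distributions, of the
classical wave solutions of some wave pair `(u, π)` for `A`. -/
def IsWaveSolution (A : Matrix (Fin l) (Fin k) (MvPolynomial (Fin n) ℂ))
    (φ : Fin k → Distr n) : Prop :=
  ∃ (u : Fin k → ℂ) (π : Submodule ℝ (E n)), IsWavePair A u π ∧
    φ ∈ closure (classicalWaves u π : Set (Fin k → Distr n))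

/-- The linear map `ℝⁿ → ℝʳ`, `x ↦ S x`, of a real `r × n` matrix. -/
def applyMat {r : ℕ} (S : Matrix (Fin r) (Fin n) ℝ) (x : E n) : E r :=
  WithLp.toLp 2 (S *ᵥ x.ofLp)

/-- `δ` is an essentially bounded measurable function on `ℝʳ` that is not (almost everywhere)
equal to a constant; equivalently, a bounded nonconstant distribution on `ℝʳ`. -/
def BoundedNonconstant {r : ℕ} (δ : E r → ℂ) : Prop :=
  MemLp δ ⊤ volume ∧ ¬ ∃ c : ℂ, δ =ᵐ[volume] fun _ => c

end WavePDE

end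

noncomputable section

namespace WavePDE

open Filter Topology SchwartzMap
open scoped SchwartzMap FourierTransform ContDiff Convolution

/-! ### Dilated multipliers and cutoffs on Schwartz space. -/

section Schwartz

variable {V : Type*} [NormedAddCommGroup V] [NormedSpace ℝ V]

/-! From the cone to waves: apply the cone condition to the row space of `S`. It gives `y = Sᵀz ≠ 0`
with `A(y)u = 0`, and by homogeneity `u` together with the line `ℝy` is a wave pair. Pulling `exp(i
z·w)` back along `S` gives the simple wave `exp(i y·x)`. Wave solutions are solutions because each
simple wave is one and the solution space is closed.

From solutions back to the cone, the argument is a Liouville theorem. Suppose `A(y)u ≠ 0` for every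
nonzero `y` in some `r`-dimensional `σ`. Let the rows of `S` be an orthonormal basis of `σ` and put
`g = δ ∘ S`. The Fourier transform of `g` is annihilated by the entries of `A(ξ)u`, since `g·u` is a
solution, and by `ξ·w` for `w ∈ σᗮ`, since `g` is invariant along `σᗮ`. These multipliers vanish
together only at `0`, so the transform is supported at the origin (`eq_zero_of_eventuallyEq_zero`).
Boundedness of `g` excludes derivatives of the Dirac mass (`fourier_apply_eq_zero_of_apply_zero`).
Hence `g`, and with it `δ`, is constant almost everywhere, a contradiction. -/

theorem hasTemperateGrowth_dilation (h : 𝓢(V, ℂ)) (ε : ℝ) :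
    (fun x => h (ε • x)).HasTemperateGrowth :=
  h.hasTemperateGrowth.comp (ContinuousLinearMap.hasTemperateGrowth (ε • ContinuousLinearMap.id ℝ V))

theorem exists_norm_iteratedFDeriv_dilation_sub_le (h : 𝓢(V, ℂ)) (j : ℕ) :
    ∃ C : ℝ, 0 ≤ C ∧ ∀ (ε : ℝ) (x : V), |ε| ≤ 1 →
      ‖iteratedFDeriv ℝ j (fun x => h (ε • x) - h 0) x‖ ≤ |ε| * (C * (1 + ‖x‖)) := by
  rcases j with - | j
  · refine ⟨SchwartzMap.seminorm ℝ 0 1 h, apply_nonneg _ _, fun ε x _ => ?_⟩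
    have hd : ∀ y ∈ (Set.univ : Set V), DifferentiableAt ℝ h y := fun y _ => h.differentiableAt
    have hb : ∀ y ∈ (Set.univ : Set V), ‖fderiv ℝ h y‖ ≤ SchwartzMap.seminorm ℝ 0 1 h := by
      intro y _
      have := h.norm_iteratedFDeriv_le_seminorm ℝ 1 y
      rwa [← norm_iteratedFDeriv_fderiv, norm_iteratedFDeriv_zero] at this
    have := convex_univ.norm_image_sub_le_of_norm_fderiv_le hd hb
      (Set.mem_univ (0 : V)) (Set.mem_univ (ε • x))
    rw [norm_iteratedFDeriv_zero]
    refine this.trans ?_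
    rw [sub_zero, norm_smul, Real.norm_eq_abs]
    have h0 : 0 ≤ SchwartzMap.seminorm ℝ 0 1 h := apply_nonneg _ _
    nlinarith [abs_nonneg ε, norm_nonneg x, mul_nonneg h0 (abs_nonneg ε)]
  · refine ⟨SchwartzMap.seminorm ℝ 0 (j + 1) h, apply_nonneg _ _, fun ε x hε => ?_⟩
    have h1 : iteratedFDeriv ℝ (j + 1) (fun x => h (ε • x) - h 0) x =
        ε ^ (j + 1) • iteratedFDeriv ℝ (j + 1) h (ε • x) := by
      have e : (fun x => h (ε • x) - h 0) = (fun x => h (ε • x)) - fun _ => h 0 := rfl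
      have hs : ContDiff ℝ (j + 1 : ℕ) h := h.smooth (j + 1 : ℕ)
      rw [e, iteratedFDeriv_sub_apply (by fun_prop) (by fun_prop),
        iteratedFDeriv_const_of_ne (by omega), iteratedFDeriv_comp_const_smul ε hs]
      simp
    rw [h1, norm_smul, norm_pow, Real.norm_eq_abs]
    have h2 := h.norm_iteratedFDeriv_le_seminorm ℝ (j + 1) (ε • x)
    have h3 : |ε| ^ (j + 1) ≤ |ε| := by
      rw [pow_succ]
      exact mul_le_of_le_one_left (abs_nonneg _) (pow_le_one₀ (abs_nonneg _) hε)
    refine mul_le_mul h3 (h2.trans ?_) (norm_nonneg _) (abs_nonneg _)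
    exact le_mul_of_one_le_right (apply_nonneg _ _) (by linarith [norm_nonneg x])

/-- By the Leibniz rule; the linear growth of the bound on `h(ε·) - h 0` costs one extra power of
`‖x‖`, absorbed by the decay of `ψ`. Used with `h` a cutoff to obtain density, and with `h 0 = 0` in
the Liouville argument. -/
theorem tendsto_smulLeftCLM_dilation (h ψ : 𝓢(V, ℂ)) :
    Tendsto (fun ε : ℝ => smulLeftCLM ℂ (fun x => h (ε • x)) ψ) (𝓝 0) (𝓝 (h 0 • ψ)) := by
  rw [(schwartz_withSeminorms ℝ V ℂ).tendsto_nhds]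
  rintro ⟨k, n⟩ η hη
  choose C hC0 hC using exists_norm_iteratedFDeriv_dilation_sub_le h
  set K : ℝ := ∑ j ∈ Finset.range (n + 1), (n.choose j : ℝ) * C j *
    (SchwartzMap.seminorm ℝ k (n - j) ψ + SchwartzMap.seminorm ℝ (k + 1) (n - j) ψ) with hK
  have key : ∀ ε : ℝ, |ε| ≤ 1 →
      SchwartzMap.seminorm ℝ k n (smulLeftCLM ℂ (fun x => h (ε • x)) ψ - h 0 • ψ) ≤ |ε| * K := by
    intro ε hε
    have hK0 : 0 ≤ K := Finset.sum_nonneg fun j _ => by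
      have := hC0 j
      positivity
    refine SchwartzMap.seminorm_le_bound ℝ k n _ (by positivity) fun x => ?_
    have e : ⇑(smulLeftCLM ℂ (fun x => h (ε • x)) ψ - h 0 • ψ) =
        fun x => (h (ε • x) - h 0) * ψ x := by
      ext y
      simp [smulLeftCLM_apply_apply (hasTemperateGrowth_dilation h ε), sub_mul]
    rw [e]
    have hh : ContDiff ℝ n h := h.smooth n
    have hψ : ContDiff ℝ n ψ := ψ.smooth n
    have := norm_iteratedFDeriv_mul_le (𝕜 := ℝ) (N := n) (f := fun x => h (ε • x) - h 0) (g := ψ)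
      (by fun_prop) hψ x (n := n) le_rfl
    refine (mul_le_mul_of_nonneg_left this (by positivity)).trans ?_
    rw [hK, Finset.mul_sum, Finset.mul_sum]
    refine Finset.sum_le_sum fun j _ => ?_
    have a1 := hC j ε x hε
    have a2 := ψ.le_seminorm ℝ k (n - j) x
    have a3 := ψ.le_seminorm ℝ (k + 1) (n - j) x
    calc ‖x‖ ^ k * (n.choose j * ‖iteratedFDeriv ℝ j (fun x => h (ε • x) - h 0) x‖ *
          ‖iteratedFDeriv ℝ (n - j) ψ x‖)
        ≤ ‖x‖ ^ k * (n.choose j * (|ε| * (C j * (1 + ‖x‖))) *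
          ‖iteratedFDeriv ℝ (n - j) ψ x‖) := by gcongr
      _ = |ε| * (n.choose j * C j * (‖x‖ ^ k * ‖iteratedFDeriv ℝ (n - j) ψ x‖ +
            ‖x‖ ^ (k + 1) * ‖iteratedFDeriv ℝ (n - j) ψ x‖)) := by ring
      _ ≤ _ := by
        have := hC0 j
        gcongr
  have hlim : Tendsto (fun ε : ℝ => |ε| * K) (𝓝 0) (𝓝 0) := by
    have : Continuous fun ε : ℝ => |ε| * K := by fun_prop
    simpa using this.tendsto 0
  have h1 : ∀ᶠ ε : ℝ in 𝓝 0, |ε| ≤ 1 := by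
    have := Metric.closedBall_mem_nhds (0 : ℝ) one_pos
    filter_upwards [this] with ε hε
    simpa using hε
  filter_upwards [h1, hlim.eventually (gt_mem_nhds hη)] with ε h1 h2
  exact (key ε h1).trans_lt h2

variable [FiniteDimensional ℝ V]

theorem exists_compactlySupported_schwartz (V : Type*) [NormedAddCommGroup V] [NormedSpace ℝ V]
    [FiniteDimensional ℝ V] :
    ∃ χ : 𝓢(V, ℂ), HasCompactSupport χ ∧ χ =ᶠ[𝓝 0] 1 := by
  let b : ContDiffBump (0 : V) := default
  have h1 : HasCompactSupport (Complex.ofRealCLM ∘ b) := b.hasCompactSupport.comp_left rfl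
  have h2 : ContDiff ℝ ∞ (Complex.ofRealCLM ∘ b) := by
    exact Complex.ofRealCLM.contDiff.comp b.contDiff
  refine ⟨h1.toSchwartzMap h2, h1, ?_⟩
  filter_upwards [b.eventuallyEq_one] with x hx
  simp [hx]

theorem dense_compactlySupported_schwartz : Dense {ψ : 𝓢(V, ℂ) | HasCompactSupport ψ} := by
  intro ψ
  obtain ⟨χ, hχ, hχ1⟩ := exists_compactlySupported_schwartz V
  have h := (tendsto_smulLeftCLM_dilation χ ψ).mono_left (nhdsWithin_le_nhds (s := {0}ᶜ))
  rw [hχ1.self_of_nhds, Pi.one_apply, one_smul] at h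
  refine mem_closure_of_tendsto h ?_
  filter_upwards [self_mem_nhdsWithin] with ε hε
  have hs : HasCompactSupport fun x => χ (ε • x) :=
    hχ.comp_homeomorph (Homeomorph.smulOfNeZero ε hε)
  change HasCompactSupport _
  rw [smulLeftCLM_apply (hasTemperateGrowth_dilation χ ε)]
  exact hs.smul_right

end Schwartz

/-! ### A Liouville theorem for bounded functions, by Fourier support at the origin. -/

section Liouville

variable {V : Type*} [NormedAddCommGroup V] [InnerProductSpace ℝ V]

/-- Division by symbols: `P = ∑ |qᵢ|²` has no zero off the origin, so `h = ∑ qᵢ · (q̄ᵢ h / P)`, with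
smooth compactly supported quotients because `h` vanishes near `0`. Each `qᵢ` can then be moved onto
`U`. -/
theorem eq_zero_of_eventuallyEq_zero {ι : Type*} [Fintype ι] {U : 𝓢'(V, ℂ)} {q : ι → V → ℂ}
    (hq : ∀ i, (q i).HasTemperateGrowth) (hq0 : ∀ ξ, (∀ i, q i ξ = 0) → ξ = 0)
    (hU : ∀ i, TemperedDistribution.smulLeftCLM ℂ (q i) U = 0) {h : 𝓢(V, ℂ)}
    (hc : HasCompactSupport h) (h0 : h =ᶠ[𝓝 0] 0) : U h = 0 := by
  let P : V → ℂ := fun ξ => ∑ i, star (q i ξ) * q i ξ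
  have hP : ∀ ξ, ξ ≠ 0 → P ξ ≠ 0 := by
    intro ξ hξ hPξ
    apply hξ
    apply hq0
    have e : P ξ = ((∑ i, ‖q i ξ‖ ^ 2 : ℝ) : ℂ) := by
      simp only [P, Complex.ofReal_sum]
      refine Finset.sum_congr rfl fun i _ => ?_
      simpa using Complex.conj_mul' (q i ξ)
    rw [e, Complex.ofReal_eq_zero, Finset.sum_eq_zero_iff_of_nonneg (fun _ _ => by positivity)] at hPξ
    intro i
    simpa using hPξ i (Finset.mem_univ i)
  have hqs : ∀ i, ContDiff ℝ ∞ (q i) := fun i => (hq i).1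
  have hqc : ∀ i, ContDiff ℝ ∞ fun ξ => star (q i ξ) := fun i =>
    Complex.conjCLE.contDiff.comp (hqs i)
  have hPs : ContDiff ℝ ∞ P := ContDiff.sum fun i _ => (hqc i).mul (hqs i)
  let f : ι → V → ℂ := fun i ξ => star (q i ξ) * h ξ / P ξ
  have hf : ∀ i, ContDiff ℝ ∞ (f i) := by
    intro i
    rw [contDiff_iff_contDiffAt]
    intro ξ
    by_cases hξ : ξ = 0
    · subst hξ
      refine (contDiffAt_const (c := (0 : ℂ))).congr_of_eventuallyEq ?_
      filter_upwards [h0] with x hx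
      simp [f, hx]
    · have := (((hqc i).contDiffAt (x := ξ)).mul (h.smooth ⊤).contDiffAt).mul
        (hPs.contDiffAt.inv (hP ξ hξ))
      simp only [f, div_eq_mul_inv]
      exact this
  have hfc : ∀ i, HasCompactSupport (f i) := by
    intro i
    refine hc.mono fun ξ hξ hh => hξ ?_
    simp [f, hh]
  have e : h = ∑ i, smulLeftCLM ℂ (q i) ((hfc i).toSchwartzMap (hf i)) := by
    ext ξ
    simp only [_root_.sum_apply, smulLeftCLM_apply_apply (hq _), smul_eq_mul]
    by_cases hξ : ξ = 0
    · subst hξ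
      have : h 0 = 0 := h0.self_of_nhds
      simp [f, this]
    · have e2 : ∀ i, q i ξ * f i ξ = (star (q i ξ) * q i ξ) * (h ξ / P ξ) := by
        intro i
        simp only [f]
        ring
      have e3 : ∑ i, q i ξ * f i ξ = h ξ := by
        simp only [e2, ← Finset.sum_mul]
        exact mul_div_cancel₀ _ (hP ξ hξ)
      exact e3.symm
  rw [e, map_sum]
  refine Finset.sum_eq_zero fun i _ => ?_
  rw [← TemperedDistribution.smulLeftCLM_apply_apply, hU i]
  rfl

variable [FiniteDimensional ℝ V] [MeasurableSpace V] [BorelSpace V]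

theorem fourier_comp_inv_smul (k : V → ℂ) {ε : ℝ} (hε : 0 < ε) (w : V) :
    𝓕 (fun v => k (ε⁻¹ • v)) w = (ε ^ Module.finrank ℝ V : ℝ) • 𝓕 k (ε • w) := by
  rw [Real.fourier_eq, Real.fourier_eq]
  have := Measure.integral_comp_inv_smul_of_nonneg volume
    (fun v : V => Real.fourierChar (-inner ℝ v (ε • w)) • k v) hε.le
  rw [← this]
  congr 1
  ext v
  congr 3
  rw [inner_smul_left, inner_smul_right]
  simp [hε.ne']

theorem integral_norm_fourier_comp_inv_smul (k : V → ℂ) {ε : ℝ} (hε : 0 < ε) :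
    ∫ w, ‖𝓕 (fun v => k (ε⁻¹ • v)) w‖ = ∫ w, ‖𝓕 k w‖ := by
  simp only [fourier_comp_inv_smul k hε, norm_smul]
  rw [integral_const_mul, Measure.integral_comp_smul_of_nonneg volume (fun w => ‖𝓕 k w‖) ε (hR := hε.le)]
  have : ε ^ Module.finrank ℝ V ≠ 0 := by positivity
  simp [abs_of_pos hε, this]

theorem tendsto_integral_norm_fourier {ι : Type*} {l : Filter ι} {ψ : ι → 𝓢(V, ℂ)}
    (h : Tendsto ψ l (𝓝 0)) : Tendsto (fun i => ∫ w, ‖𝓕 (ψ i) w‖) l (𝓝 0) := by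
  have hc : Continuous fun φ : 𝓢(V, ℂ) => ‖toLpCLM ℂ ℂ 1 volume (FourierTransform.fourierCLM ℂ 𝓢(V, ℂ) φ)‖ := by
    fun_prop
  have := (hc.tendsto 0).comp h
  simpa [Function.comp_def, norm_toLp_one] using this

/-- Here the `L¹` bound on `L` excludes derivatives of the Dirac mass. Cutting `h` off at scale `ε`
changes it only away from `0`, so `𝓕 L h = L (𝓕 g)` with `g = χ(·/ε) h`. This `g` is a dilate of
`h(ε·) χ`, which tends to `h 0 • χ = 0`, and the `L¹` norm of the Fourier transform is invariant
under dilation. -/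
theorem fourier_apply_eq_zero_of_apply_zero {ι : Type*} [Fintype ι] {L : 𝓢'(V, ℂ)} {M : ℝ}
    (hL : ∀ ψ, ‖L ψ‖ ≤ M * ∫ x, ‖ψ x‖) {q : ι → V → ℂ}
    (hq : ∀ i, (q i).HasTemperateGrowth) (hq0 : ∀ ξ, (∀ i, q i ξ = 0) → ξ = 0)
    (hU : ∀ i, TemperedDistribution.smulLeftCLM ℂ (q i) (𝓕 L) = 0) {h : 𝓢(V, ℂ)}
    (hc : HasCompactSupport h) (h0 : h 0 = 0) : 𝓕 L h = 0 := by
  obtain ⟨χ, hχ, hχ1⟩ := exists_compactlySupported_schwartz V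
  have hlim := (tendsto_smulLeftCLM_dilation h χ).mono_left (nhdsWithin_le_nhds (s := Set.Ioi 0))
  rw [h0, zero_smul] at hlim
  have hlim2 := (tendsto_integral_norm_fourier hlim).const_mul M
  rw [mul_zero] at hlim2
  rw [← norm_le_zero_iff]
  refine ge_of_tendsto hlim2 ?_
  filter_upwards [self_mem_nhdsWithin] with ε (hε : 0 < ε)
  set g := smulLeftCLM ℂ (fun x => χ (ε⁻¹ • x)) h with hg
  have hgx : ∀ x, g x = χ (ε⁻¹ • x) * h x := fun x => by
    rw [hg, smulLeftCLM_apply_apply (hasTemperateGrowth_dilation χ _), smul_eq_mul]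
  have hgc : HasCompactSupport g := by
    refine hc.mono fun ξ hξ hh => hξ ?_
    rw [hgx, hh, mul_zero]
  have h1 : 𝓕 L (h - g) = 0 := by
    refine eq_zero_of_eventuallyEq_zero hq hq0 hU (hc.sub hgc) ?_
    have ht : Tendsto (fun x : V => ε⁻¹ • x) (𝓝 0) (𝓝 0) := by
      have : Continuous fun x : V => ε⁻¹ • x := by fun_prop
      simpa using this.tendsto 0
    filter_upwards [ht.eventually hχ1] with x hx
    simp [hgx, hx]
  rw [map_sub, sub_eq_zero] at h1
  rw [h1, TemperedDistribution.fourier_apply]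
  refine (hL _).trans_eq ?_
  congr 1
  have e : (fun v => smulLeftCLM ℂ (fun x => h (ε • x)) χ (ε⁻¹ • v)) = g := by
    ext v
    rw [smulLeftCLM_apply_apply (hasTemperateGrowth_dilation h _), hgx, smul_inv_smul₀ hε.ne',
      smul_eq_mul, mul_comm]
  have e2 := integral_norm_fourier_comp_inv_smul (smulLeftCLM ℂ (fun x => h (ε • x)) χ) hε
  rw [e] at e2
  exact e2

theorem exists_eq_integral_of_symbols {ι : Type*} [Fintype ι] {L : 𝓢'(V, ℂ)} {M : ℝ}
    (hL : ∀ ψ, ‖L ψ‖ ≤ M * ∫ x, ‖ψ x‖) {q : ι → V → ℂ}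
    (hq : ∀ i, (q i).HasTemperateGrowth) (hq0 : ∀ ξ, (∀ i, q i ξ = 0) → ξ = 0)
    (hU : ∀ i, TemperedDistribution.smulLeftCLM ℂ (q i) (𝓕 L) = 0) :
    ∃ c : ℂ, ∀ ψ : 𝓢(V, ℂ), L ψ = c * ∫ x, ψ x := by
  obtain ⟨χ, hχ, hχ1⟩ := exists_compactlySupported_schwartz V
  have key : ∀ h : 𝓢(V, ℂ), 𝓕 L h = 𝓕 L χ * h 0 := by
    have hev : Continuous fun h : 𝓢(V, ℂ) => h 0 := by
      have : Continuous fun h : 𝓢(V, ℂ) => toBoundedContinuousFunctionCLM ℂ V ℂ h 0 := by fun_prop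
      exact this
    have hcont : Continuous fun h : 𝓢(V, ℂ) => 𝓕 L h := map_continuous (𝓕 L)
    refine fun h => congrFun (Continuous.ext_on dense_compactlySupported_schwartz hcont
      (continuous_const.mul hev) fun h (hh : HasCompactSupport h) => ?_) h
    have := fourier_apply_eq_zero_of_apply_zero hL hq hq0 hU (h := h - h 0 • χ)
      (hh.sub (hχ.smul_left (f := fun _ => h 0))) (by simp [hχ1.self_of_nhds])
    rw [map_sub, map_smul, sub_eq_zero] at this
    rw [this, smul_eq_mul, mul_comm]
    rfl
  refine ⟨𝓕 L χ, fun ψ => ?_⟩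
  -- The value of `𝓕⁻ ψ` at `0` is `∫ ψ`.
  have := key (𝓕⁻ ψ)
  rw [TemperedDistribution.fourier_apply, FourierTransform.fourier_fourierInv_eq] at this
  rw [this, fourierInv_coe, Real.fourierInv_eq]
  simp

end Liouville

/-! ### Differential operators as Fourier multipliers on tempered representatives. -/

section Representation

variable {n : ℕ}

/-- A real test function, regarded as a complex Schwartz function. -/
def testToSchwartz (f : 𝓓((⊤ : TopologicalSpace.Opens (E n)), ℝ)) : 𝓢(E n, ℂ) :=
  HasCompactSupport.toSchwartzMap (f := fun x => (f x : ℂ))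
    (f.hasCompactSupport.comp_left (g := Complex.ofReal) rfl)
    (Complex.ofRealCLM.contDiff.comp f.contDiff)

@[simp]
theorem testToSchwartz_apply (f : 𝓓((⊤ : TopologicalSpace.Opens (E n)), ℝ)) (x : E n) :
    testToSchwartz f x = f x := rfl

theorem testToSchwartz_lineDeriv (f : 𝓓((⊤ : TopologicalSpace.Opens (E n)), ℝ)) (v : E n) :
    testToSchwartz (∂_{v} f) = ∂_{v} (testToSchwartz f) := by
  ext x
  have hf : DifferentiableAt ℝ f x := (f.contDiff.differentiable (by simp)).differentiableAt
  have h := (Complex.ofRealCLM.hasFDerivAt (x := f x)).comp x hf.hasFDerivAt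
  have h' : fderiv ℝ (testToSchwartz f) x = Complex.ofRealCLM.comp (fderiv ℝ f x) := h.fderiv
  rw [SchwartzMap.lineDerivOp_apply_eq_fderiv, h', testToSchwartz_apply,
    TestFunction.lineDerivOp_eq_lineDerivCLM ℝ, TestFunction.lineDerivCLM_eq_fderivCLM,
    TestFunction.fderivCLM_apply_of_le _ (by simp)]
  rfl

/-- The distribution `T` is the restriction of the tempered distribution `L`. -/
def Represents (T : Distr n) (L : 𝓢'(E n, ℂ)) : Prop :=
  ∀ f, T f = L (testToSchwartz f)

theorem Represents.lineDeriv {T : Distr n} {L : 𝓢'(E n, ℂ)} (h : Represents T L) (v : E n) :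
    Represents (∂_{v} T) (∂_{v} L) := by
  intro f
  rw [Distribution.lineDerivOp_apply_apply, map_neg, h, TemperedDistribution.lineDerivOp_apply_apply,
    map_neg, testToSchwartz_lineDeriv]

theorem Represents.add {T T' : Distr n} {L L' : 𝓢'(E n, ℂ)} (h : Represents T L)
    (h' : Represents T' L') : Represents (T + T') (L + L') := by
  intro f
  exact congrArg₂ (· + ·) (h f) (h' f)

theorem Represents.smul {T : Distr n} {L : 𝓢'(E n, ℂ)} (h : Represents T L) (c : ℂ) :
    Represents (c • T) (c • L) := by
  intro f
  exact congrArg (c • ·) (h f)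

theorem Represents.sum {ι : Type*} {s : Finset ι} {T : ι → Distr n} {L : ι → 𝓢'(E n, ℂ)}
    (h : ∀ i ∈ s, Represents (T i) (L i)) : Represents (∑ i ∈ s, T i) (∑ i ∈ s, L i) := by
  classical
  induction s using Finset.induction_on with
  | empty => intro f; rfl
  | insert a s ha ih =>
    rw [Finset.sum_insert ha, Finset.sum_insert ha]
    exact (h a (Finset.mem_insert_self a s)).add
      (ih fun i hi => h i (Finset.mem_insert_of_mem hi))

theorem Represents.multiplier_comp {T : Distr n} {L : 𝓢'(E n, ℂ)} {q₁ q₂ q : E n → ℂ}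
    (h₁ : q₁.HasTemperateGrowth) (h₂ : q₂.HasTemperateGrowth) (hq : ∀ ξ, q ξ = q₁ ξ * q₂ ξ)
    (h : Represents T (TemperedDistribution.fourierMultiplierCLM ℂ q₂
      (TemperedDistribution.fourierMultiplierCLM ℂ q₁ L))) :
    Represents T (TemperedDistribution.fourierMultiplierCLM ℂ q L) := by
  rw [TemperedDistribution.fourierMultiplierCLM_fourierMultiplierCLM_apply h₁ h₂] at h
  rwa [show q = q₁ * q₂ from funext hq]

theorem Represents.multiplier_const_mul {T : Distr n} {L : 𝓢'(E n, ℂ)} {q : E n → ℂ} {c : ℂ}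
    (hq : q.HasTemperateGrowth)
    (h : Represents T (c • TemperedDistribution.fourierMultiplierCLM ℂ q L)) :
    Represents T (TemperedDistribution.fourierMultiplierCLM ℂ (fun ξ => c * q ξ) L) := by
  have e := TemperedDistribution.fourierMultiplierCLM_smul (F := ℂ) hq c
  rw [show (fun ξ => c * q ξ) = c • q from rfl, e]
  exact h

theorem Represents.multiplier_sum {ι : Type*} {s : Finset ι} {T : ι → Distr n} {L : 𝓢'(E n, ℂ)}
    {q : ι → E n → ℂ} (hq : ∀ i ∈ s, (q i).HasTemperateGrowth)
    (h : ∀ i ∈ s, Represents (T i) (TemperedDistribution.fourierMultiplierCLM ℂ (q i) L)) :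
    Represents (∑ i ∈ s, T i)
      (TemperedDistribution.fourierMultiplierCLM ℂ (fun ξ => ∑ i ∈ s, q i ξ) L) := by
  rw [TemperedDistribution.fourierMultiplierCLM_sum (F := ℂ) hq, _root_.sum_apply]
  exact Represents.sum h

theorem Represents.partialD {T : Distr n} {L : 𝓢'(E n, ℂ)} (h : Represents T L) (i : Fin n) :
    Represents (partialD i T) (TemperedDistribution.fourierMultiplierCLM ℂ
      (fun ξ => 2 * Real.pi * Complex.I * (ξ i : ℂ)) L) := by
  have e := TemperedDistribution.lineDeriv_eq_fourierMultiplierCLM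
    (EuclideanSpace.single i (1 : ℝ)) L
  have hg : (fun ξ : E n => ((inner ℝ ξ (EuclideanSpace.single i (1 : ℝ)) : ℝ) : ℂ)).HasTemperateGrowth := by
    fun_prop
  have e2 := TemperedDistribution.fourierMultiplierCLM_smul (F := ℂ) hg (2 * Real.pi * Complex.I)
  have e3 : (fun ξ : E n => 2 * Real.pi * Complex.I * (ξ i : ℂ)) = (2 * Real.pi * Complex.I : ℂ) •
      fun ξ : E n => ((inner ℝ ξ (EuclideanSpace.single i (1 : ℝ)) : ℝ) : ℂ) := by
    ext ξ
    simp [EuclideanSpace.inner_single_right]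
  rw [e3, e2]
  have := h.lineDeriv (EuclideanSpace.single i (1 : ℝ))
  rw [e] at this
  exact this

theorem hasTemperateGrowth_coord (i : Fin n) :
    (fun ξ : E n => 2 * Real.pi * Complex.I * (ξ i : ℂ)).HasTemperateGrowth := by
  have h : (fun ξ : E n => ((EuclideanSpace.proj i : E n →L[ℝ] ℝ) ξ : ℂ)).HasTemperateGrowth := by
    fun_prop
  exact (Function.HasTemperateGrowth.const (2 * Real.pi * Complex.I : ℂ)).mul h

theorem Represents.partialD_pow {T : Distr n} {L : 𝓢'(E n, ℂ)} (h : Represents T L) (i : Fin n)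
    (k : ℕ) :
    Represents ((WavePDE.partialD i ^ k) T) (TemperedDistribution.fourierMultiplierCLM ℂ
      (fun ξ => (2 * Real.pi * Complex.I * (ξ i : ℂ)) ^ k) L) := by
  induction k with
  | zero => simpa using h
  | succ k ih =>
    rw [pow_succ', mul_apply_eq_comp]
    exact (ih.partialD i).multiplier_comp ((hasTemperateGrowth_coord i).pow k)
      (hasTemperateGrowth_coord i) fun ξ => pow_succ _ _

theorem hasTemperateGrowth_list_prod (l : List (Fin n)) (m : Fin n →₀ ℕ) :
    (fun ξ : E n => (l.map fun i =>
      (2 * Real.pi * Complex.I * (ξ i : ℂ)) ^ m i).prod).HasTemperateGrowth := by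
  induction l with
  | nil => exact Function.HasTemperateGrowth.const (1 : ℂ)
  | cons i l ih =>
    simp only [List.map_cons, List.prod_cons]
    exact ((hasTemperateGrowth_coord i).pow (m i)).mul ih

theorem Represents.list_prod {T : Distr n} {L : 𝓢'(E n, ℂ)} (h : Represents T L)
    (l : List (Fin n)) (m : Fin n →₀ ℕ) :
    Represents ((l.map fun i => WavePDE.partialD i ^ m i).prod T)
      (TemperedDistribution.fourierMultiplierCLM ℂ
        (fun ξ => (l.map fun i => (2 * Real.pi * Complex.I * (ξ i : ℂ)) ^ m i).prod) L) := by
  induction l with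
  | nil => simpa using h
  | cons i l ih =>
    rw [List.map_cons, List.prod_cons, mul_apply_eq_comp]
    refine (ih.partialD_pow i (m i)).multiplier_comp (hasTemperateGrowth_list_prod l m)
      ((hasTemperateGrowth_coord i).pow (m i)) fun ξ => ?_
    rw [List.map_cons, List.prod_cons, mul_comm]
    rfl

theorem polynomial_eval_eq (p : MvPolynomial (Fin n) ℂ) (ξ : E n) :
    MvPolynomial.eval (fun i => 2 * Real.pi * Complex.I * (ξ i : ℂ)) p =
      ∑ m ∈ p.support, p.coeff m *
        ((List.finRange n).map fun i => (2 * Real.pi * Complex.I * (ξ i : ℂ)) ^ m i).prod := by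
  simp only [MvPolynomial.eval_eq', Fin.prod_univ_def]

theorem hasTemperateGrowth_polynomial (p : MvPolynomial (Fin n) ℂ) :
    (fun ξ : E n =>
      MvPolynomial.eval (fun i => 2 * Real.pi * Complex.I * (ξ i : ℂ)) p).HasTemperateGrowth := by
  simp only [polynomial_eval_eq]
  exact Function.HasTemperateGrowth.sum fun m _ =>
    (Function.HasTemperateGrowth.const _).mul (hasTemperateGrowth_list_prod _ m)

theorem Represents.polyD {T : Distr n} {L : 𝓢'(E n, ℂ)} (h : Represents T L)
    (p : MvPolynomial (Fin n) ℂ) :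
    Represents (polyD p T) (TemperedDistribution.fourierMultiplierCLM ℂ
      (fun ξ => MvPolynomial.eval (fun i => 2 * Real.pi * Complex.I * (ξ i : ℂ)) p) L) := by
  simp only [polynomial_eval_eq]
  exact Represents.multiplier_sum (fun m _ => (Function.HasTemperateGrowth.const _).mul
      (hasTemperateGrowth_list_prod _ m))
    fun m _ => Represents.multiplier_const_mul (hasTemperateGrowth_list_prod _ m)
      ((h.list_prod (List.finRange n) m).smul (p.coeff m))

variable {k l d : ℕ}

theorem eval_smul_of_isHomogeneous {σ : Type*} {p : MvPolynomial σ ℂ} (hp : p.IsHomogeneous d)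
    (c : ℂ) (x : σ → ℂ) :
    MvPolynomial.eval (fun i => c * x i) p = c ^ d * MvPolynomial.eval x p := by
  rw [MvPolynomial.eval_eq, MvPolynomial.eval_eq, Finset.mul_sum]
  refine Finset.sum_congr rfl fun m hm => ?_
  have hd : ∑ i ∈ m.support, m i = d := by
    have := hp (MvPolynomial.mem_support_iff.mp hm)
    simpa [Finsupp.weight_apply, Finsupp.sum] using this
  rw [← hd, ← Finset.prod_pow_eq_pow_sum]
  simp only [mul_pow, Finset.prod_mul_distrib]
  ring

theorem symbol_mulVec_apply (A : Matrix (Fin l) (Fin k) (MvPolynomial (Fin n) ℂ)) (u : Fin k → ℂ)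
    (i : Fin l) (ξ : E n) :
    (symbol A ξ *ᵥ u) i = ∑ j, MvPolynomial.eval (fun i => (ξ i : ℂ)) (A i j) * u j := rfl

theorem scaled_symbol_eq {A : Matrix (Fin l) (Fin k) (MvPolynomial (Fin n) ℂ)}
    (hA : ∀ i j, (A i j).IsHomogeneous d) (u : Fin k → ℂ) (i : Fin l) (ξ : E n) :
    (2 * Real.pi * Complex.I) ^ d * (symbol A ξ *ᵥ u) i =
      ∑ j, u j * MvPolynomial.eval (fun i => 2 * Real.pi * Complex.I * (ξ i : ℂ)) (A i j) := by
  rw [symbol_mulVec_apply, Finset.mul_sum]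
  refine Finset.sum_congr rfl fun j _ => ?_
  rw [eval_smul_of_isHomogeneous (hA i j)]
  ring

theorem hasTemperateGrowth_scaled_symbol {A : Matrix (Fin l) (Fin k) (MvPolynomial (Fin n) ℂ)}
    (hA : ∀ i j, (A i j).IsHomogeneous d) (u : Fin k → ℂ) (i : Fin l) :
    (fun ξ : E n => (2 * Real.pi * Complex.I) ^ d * (symbol A ξ *ᵥ u) i).HasTemperateGrowth := by
  simp only [scaled_symbol_eq hA]
  exact Function.HasTemperateGrowth.sum fun j _ =>
    (Function.HasTemperateGrowth.const _).mul (hasTemperateGrowth_polynomial _)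

/-- Each `∂ᵢ` is the multiplier `2πi ξᵢ`. Since all entries have the same degree, the factors `2πi`
come out together, and the multiplier vanishes exactly where `A(ξ)u` does for real `ξ`. -/
theorem Represents.system {A : Matrix (Fin l) (Fin k) (MvPolynomial (Fin n) ℂ)}
    (hA : ∀ i j, (A i j).IsHomogeneous d) {g : E n → ℂ} {L : 𝓢'(E n, ℂ)}
    (h : Represents (ofFun g) L) (u : Fin k → ℂ) (i : Fin l) :
    Represents (∑ j, WavePDE.polyD (A i j) (waveOfFun g u j))
      (TemperedDistribution.fourierMultiplierCLM ℂ
        (fun ξ => (2 * Real.pi * Complex.I) ^ d * (symbol A ξ *ᵥ u) i) L) := by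
  simp only [scaled_symbol_eq hA]
  refine Represents.multiplier_sum (fun j _ => (Function.HasTemperateGrowth.const _).mul
      (hasTemperateGrowth_polynomial _)) fun j _ =>
    Represents.multiplier_const_mul (hasTemperateGrowth_polynomial _) ?_
  rw [← map_smul]
  exact (h.smul (u j)).polyD (A i j)

/-- Real test functions determine a tempered distribution: split into real and imaginary parts and
use density of compact support. -/
theorem Represents.eq_zero {L : 𝓢'(E n, ℂ)} (h : Represents (0 : Distr n) L) : L = 0 := by
  have hr : ∀ f : E n → ℝ, ∀ (hf : ContDiff ℝ ∞ f) (hc : HasCompactSupport f) (ψ : 𝓢(E n, ℂ)),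
      (∀ x, ψ x = f x) → L ψ = 0 := by
    intro f hf hc ψ hψ
    have := h ⟨f, hf, hc, Set.subset_univ _⟩
    have e : ψ = testToSchwartz ⟨f, hf, hc, Set.subset_univ _⟩ := by
      ext x
      exact hψ x
    rw [e, ← this]
    rfl
  have hcont : Continuous fun ψ : 𝓢(E n, ℂ) => L ψ := map_continuous L
  ext ψ
  refine congrFun (Continuous.ext_on (g := fun _ => (0 : ℂ)) dense_compactlySupported_schwartz hcont
    continuous_const fun ψ (hc : HasCompactSupport ψ) => ?_) ψ
  have hre : ContDiff ℝ ∞ fun x => (ψ x).re := Complex.reCLM.contDiff.comp (ψ.smooth ⊤)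
  have him : ContDiff ℝ ∞ fun x => (ψ x).im := Complex.imCLM.contDiff.comp (ψ.smooth ⊤)
  have hrec : HasCompactSupport fun x => (ψ x).re := hc.comp_left (g := Complex.re) rfl
  have himc : HasCompactSupport fun x => (ψ x).im := hc.comp_left (g := Complex.im) rfl
  let a : 𝓢(E n, ℂ) := HasCompactSupport.toSchwartzMap (f := fun x => ((ψ x).re : ℂ))
    (hrec.comp_left (g := Complex.ofReal) rfl) (Complex.ofRealCLM.contDiff.comp hre)
  let b : 𝓢(E n, ℂ) := HasCompactSupport.toSchwartzMap (f := fun x => ((ψ x).im : ℂ))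
    (himc.comp_left (g := Complex.ofReal) rfl) (Complex.ofRealCLM.contDiff.comp him)
  have e : ψ = a + Complex.I • b := by
    ext x
    have := (Complex.re_add_im (ψ x)).symm
    rwa [mul_comm] at this
  change L ψ = 0
  rw [e, map_add, map_smul, hr _ hre hrec a fun _ => rfl, hr _ him himc b fun _ => rfl]
  simp

theorem exists_represents_of_memLp_top {g : E n → ℂ} (hg : MemLp g ⊤ volume) :
    ∃ L : 𝓢'(E n, ℂ), Represents (ofFun g) L ∧ (∀ ψ : 𝓢(E n, ℂ), L ψ = ∫ x, ψ x * g x) ∧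
      ∃ M : ℝ, ∀ ψ : 𝓢(E n, ℂ), ‖L ψ‖ ≤ M * ∫ x, ‖ψ x‖ := by
  have hL : ∀ ψ : 𝓢(E n, ℂ), Lp.toTemperedDistribution (hg.toLp g) ψ = ∫ x, ψ x * g x := by
    intro ψ
    rw [Lp.toTemperedDistribution_apply]
    refine integral_congr_ae ?_
    filter_upwards [hg.coeFn_toLp] with x hx
    rw [hx, smul_eq_mul]
  refine ⟨Lp.toTemperedDistribution (hg.toLp g), fun f => ?_, hL,
    (eLpNorm g ⊤ volume).toReal, fun ψ => ?_⟩
  · rw [ofFun_apply (hg.locallyIntegrable le_top), hL]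
    simp
  · rw [hL, ← integral_const_mul]
    refine norm_integral_le_of_norm_le (ψ.integrable.norm.const_mul _) ?_
    filter_upwards [ae_le_eLpNormEssSup (f := g) (μ := volume)] with x hx
    rw [norm_mul, mul_comm]
    gcongr
    have := ENNReal.toReal_mono hg.2.ne (by simpa using hx)
    simpa using this

end Representation

/-! ### The closed complex space of solutions, wave solutions, and Liouville for functions. -/

variable {n k l d r : ℕ}

/-- Multiplication of distributions by a complex constant, as a continuous linear map. -/
def constMulD (n : ℕ) (c : ℂ) : Distr n →L[ℝ] Distr n :=
  Distribution.mapCLM (c • ContinuousLinearMap.id ℝ ℂ)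

theorem constMulD_apply (c : ℂ) (T : Distr n) : constMulD n c T = c • T := by
  ext f
  rfl

/-- `partialD` is only real-linear by its type; complex linearity of the action is recovered from
this commutation. -/
theorem commute_constMulD_monomialD (c : ℂ) (m : Fin n →₀ ℕ) :
    Commute (constMulD n c) (monomialD m) := by
  refine Commute.list_prod_right _ _ fun S hS => ?_
  obtain ⟨i, -, rfl⟩ := List.mem_map.mp hS
  refine Commute.pow_right ?_ _
  ext T f
  change c • (-T _) = -(c • T _)
  simp

theorem monomialD_smul (m : Fin n →₀ ℕ) (c : ℂ) (T : Distr n) :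
    monomialD m (c • T) = c • monomialD m T := by
  have := congrArg (fun Φ : Distr n →L[ℝ] Distr n => Φ T) (commute_constMulD_monomialD c m).eq
  simp only [mul_apply_eq_comp, constMulD_apply] at this
  exact this.symm

theorem polyD_smul (p : MvPolynomial (Fin n) ℂ) (c : ℂ) (T : Distr n) :
    polyD p (c • T) = c • polyD p T := by
  simp only [polyD, monomialD_smul, Finset.smul_sum]
  exact Finset.sum_congr rfl fun m _ => smul_comm _ _ _

theorem polyD_add (p : MvPolynomial (Fin n) ℂ) (T T' : Distr n) :
    polyD p (T + T') = polyD p T + polyD p T' := by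
  simp only [polyD, map_add, smul_add, Finset.sum_add_distrib]

theorem continuous_polyD (p : MvPolynomial (Fin n) ℂ) : Continuous (polyD p) := by
  refine continuous_finsetSum _ fun m _ => ?_
  have : (fun T : Distr n => p.coeff m • monomialD m T) =
      fun T => constMulD n (p.coeff m) (monomialD m T) := by
    ext T
    rw [constMulD_apply]
  rw [this]
  fun_prop

/-- The solutions of `A • φ = 0`, as a complex subspace. -/
def solutionSpace (A : Matrix (Fin l) (Fin k) (MvPolynomial (Fin n) ℂ)) :
    Submodule ℂ (Fin k → Distr n) where
  carrier := {φ | IsSolution A φ}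
  add_mem' {φ φ'} h h' i := by
    have := congrArg₂ (· + ·) (h i) (h' i)
    simpa [polyD_add, Finset.sum_add_distrib] using this
  zero_mem' i := by
    have h (p : MvPolynomial (Fin n) ℂ) : polyD p (0 : Distr n) = 0 := by
      simpa using polyD_add p (0 : Distr n) 0
    simp [h]
  smul_mem' c φ h i := by
    have := congrArg (constMulD n c) (h i)
    simp only [map_sum, map_zero, constMulD_apply] at this
    simpa [polyD_smul] using this

theorem isClosed_solutionSpace (A : Matrix (Fin l) (Fin k) (MvPolynomial (Fin n) ℂ)) :
    IsClosed (solutionSpace A : Set (Fin k → Distr n)) := by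
  change IsClosed {φ : Fin k → Distr n | ∀ i, ∑ j, polyD (A i j) (φ j) = 0}
  simp only [Set.ofPred_forall]
  refine isClosed_iInter fun i => isClosed_eq ?_ continuous_const
  exact continuous_finsetSum _ fun j _ => (continuous_polyD _).comp (continuous_apply j)

theorem memLp_top_exp_inner (ξ : E n) :
    MemLp (fun x : E n => Complex.exp (Complex.I * ((inner ℝ ξ x : ℝ) : ℂ))) ⊤ volume := by
  refine memLp_top_of_bound (by fun_prop) 1 (ae_of_all _ fun x => ?_)
  rw [mul_comm, Complex.norm_exp_ofReal_mul_I]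

theorem isSolution_simpleWave {A : Matrix (Fin l) (Fin k) (MvPolynomial (Fin n) ℂ)}
    (hA : ∀ i j, (A i j).IsHomogeneous d) {u : Fin k → ℂ} {π : Submodule ℝ (E n)}
    (h : IsWavePair A u π) {ξ : E n} (hξ : ξ ∈ π) : IsSolution A (simpleWave ξ u) := by
  intro i
  obtain ⟨L, hrep, hL, -⟩ := exists_represents_of_memLp_top (memLp_top_exp_inner ξ)
  -- The Fourier transform of the wave is the Dirac mass at `ξ / 2π`, a frequency still in `π`.
  have hfourier : ∀ ψ : 𝓢(E n, ℂ), L (𝓕 ψ) = ψ ((2 * Real.pi)⁻¹ • ξ) := by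
    intro ψ
    conv_rhs => rw [← FourierTransform.fourierInv_fourier_eq (F := 𝓢(E n, ℂ)) ψ, fourierInv_coe, Real.fourierInv_eq]
    rw [hL]
    refine integral_congr_ae (ae_of_all _ fun x => ?_)
    simp only
    rw [Circle.smul_def, smul_eq_mul, mul_comm, Real.fourierChar_apply, inner_smul_right,
      real_inner_comm]
    congr 2
    push_cast
    field_simp
  have hq := congrFun (h _ (π.smul_mem (2 * Real.pi)⁻¹ hξ)) i
  ext f
  have := hrep.system hA u i f
  rw [TemperedDistribution.fourierMultiplierCLM_apply_apply, hfourier,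
    smulLeftCLM_apply_apply (hasTemperateGrowth_scaled_symbol hA u i), hq] at this
  simpa [simpleWave] using this

theorem IsWaveSolution.isSolution {A : Matrix (Fin l) (Fin k) (MvPolynomial (Fin n) ℂ)}
    (hA : ∀ i j, (A i j).IsHomogeneous d) {φ : Fin k → Distr n} (h : IsWaveSolution A φ) :
    IsSolution A φ := by
  obtain ⟨v, π, hpair, hφ⟩ := h
  have hle : classicalWaves v π ≤ solutionSpace A := by
    refine Submodule.span_le.mpr ?_
    rintro _ ⟨ξ, hξ, rfl⟩
    exact isSolution_simpleWave hA hpair hξ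
  exact closure_minimal hle (isClosed_solutionSpace A) hφ

theorem ae_const_of_annihilated {g : E n → ℂ} (hg : MemLp g ⊤ volume) {ι : Type*} [Fintype ι]
    {q : ι → E n → ℂ} (hq : ∀ i, (q i).HasTemperateGrowth)
    (hq0 : ∀ ξ, (∀ i, q i ξ = 0) → ξ = 0)
    (h : ∀ (L : 𝓢'(E n, ℂ)), Represents (ofFun g) L → ∀ i,
      Represents 0 (TemperedDistribution.fourierMultiplierCLM ℂ (q i) L)) :
    ∃ c : ℂ, g =ᵐ[volume] fun _ => c := by
  obtain ⟨L, hrep, hL, M, hM⟩ := exists_represents_of_memLp_top hg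
  have hU : ∀ i, TemperedDistribution.smulLeftCLM ℂ (q i) (𝓕 L) = 0 := by
    intro i
    have := (h L hrep i).eq_zero
    rw [TemperedDistribution.fourierMultiplierCLM_apply] at this
    have h2 := congrArg (𝓕 ·) this
    simp only [FourierTransform.fourier_fourierInv_eq] at h2
    rw [h2]
    exact FourierTransform.fourier_zero
  obtain ⟨c, hc⟩ := exists_eq_integral_of_symbols hM hq hq0 hU
  refine ⟨c, ae_eq_of_integral_contDiff_smul_eq (hg.locallyIntegrable le_top)
    (locallyIntegrable_const c) fun f hf hfc => ?_⟩
  have h1 := hrep ⟨f, hf, hfc, Set.subset_univ _⟩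
  rw [ofFun_apply (hg.locallyIntegrable le_top), hc] at h1
  refine h1.trans ?_
  rw [← integral_const_mul]
  refine integral_congr_ae (ae_of_all _ fun x => ?_)
  simp only [testToSchwartz_apply, Complex.real_smul]
  exact mul_comm _ _

/-! ### Pullback along a surjective linear map. -/

/-- The linear map `x ↦ S x` on Euclidean spaces. -/
def applyMatLM (S : Matrix (Fin r) (Fin n) ℝ) : E n →ₗ[ℝ] E r where
  toFun := applyMat S
  map_add' x y := by ext i; simp [applyMat, Matrix.mulVec_add]
  map_smul' c x := by ext i; simp [applyMat, Matrix.mulVec_smul]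

theorem surjective_applyMatLM {S : Matrix (Fin r) (Fin n) ℝ} (hS : S.rank = r) :
    Function.Surjective (applyMatLM S) := by
  have h : LinearMap.range S.mulVecLin = ⊤ :=
    Submodule.eq_top_of_finrank_eq (by simpa [Matrix.rank] using hS)
  intro y
  obtain ⟨x, hx⟩ := LinearMap.range_eq_top.mp h y.ofLp
  exact ⟨WithLp.toLp 2 x, congrArg (WithLp.toLp 2) hx⟩

/-- The pushforward of Lebesgue measure is a multiple of Lebesgue measure, infinite when `r < n`, so
null sets still pull back to null sets. -/
theorem quasiMeasurePreserving_applyMatLM {S : Matrix (Fin r) (Fin n) ℝ} (hS : S.rank = r) :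
    Measure.QuasiMeasurePreserving (applyMatLM S) volume volume := by
  obtain ⟨c, -, hc⟩ := (applyMatLM S).exists_map_addHaar_eq_smul_addHaar volume volume
    (surjective_applyMatLM hS)
  refine ⟨(applyMatLM S).continuous_of_finiteDimensional.measurable, ?_⟩
  rw [hc]
  exact Measure.smul_absolutelyContinuous

theorem memLp_top_comp_applyMat {δ : E r → ℂ} (hδ : MemLp δ ⊤ volume)
    {S : Matrix (Fin r) (Fin n) ℝ} (hS : S.rank = r) :
    MemLp (fun x => δ (applyMat S x)) ⊤ volume := by
  have hqmp := quasiMeasurePreserving_applyMatLM hS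
  refine memLp_top_of_bound (hδ.1.comp_quasiMeasurePreserving hqmp)
    (eLpNorm δ ⊤ volume).toReal ?_
  refine hqmp.ae (p := fun y => ‖δ y‖ ≤ (eLpNorm δ ⊤ volume).toReal) ?_
  filter_upwards [ae_le_eLpNormEssSup (f := δ) (μ := volume)] with x hx
  have := ENNReal.toReal_mono hδ.2.ne (by simpa using hx)
  simpa using this

theorem ae_const_of_comp_applyMat {δ : E r → ℂ} (hδ : AEStronglyMeasurable δ volume)
    {S : Matrix (Fin r) (Fin n) ℝ} (hS : S.rank = r) {c : ℂ}
    (h : (fun x => δ (applyMat S x)) =ᵐ[volume] fun _ => c) : δ =ᵐ[volume] fun _ => c := by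
  have hsurj := surjective_applyMatLM hS
  have hqmp := quasiMeasurePreserving_applyMatLM hS
  have hm : MeasurableSet (hδ.mk δ ⁻¹' {c}) :=
    hδ.stronglyMeasurable_mk.measurable (measurableSet_singleton c)
  have h1 := (ae_comp_linearMap_mem_iff (applyMatLM S) (volume : Measure (E n))
    (volume : Measure (E r)) hsurj hm).mp (by
      filter_upwards [h, hqmp.ae hδ.ae_eq_mk] with x hx hx2
      exact hx2.symm.trans hx)
  filter_upwards [h1, hδ.ae_eq_mk] with y hy hy2
  exact hy2.trans hy

theorem not_ae_const_exp_inner {z : E r} (hz : z ≠ 0) :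
    ¬ ∃ c : ℂ, (fun w : E r => Complex.exp (Complex.I * ((inner ℝ z w : ℝ) : ℂ)))
      =ᵐ[volume] fun _ => c := by
  rintro ⟨c, hc⟩
  have h := (Continuous.ae_eq_iff_eq volume (by fun_prop) continuous_const).mp hc
  have h0 := congrFun h 0
  -- At this point the phase equals `π`, so the exponential is `-1`, against `1` at the origin.
  have h1 := congrFun h ((Real.pi / ‖z‖ ^ 2) • z)
  have hz' : ‖z‖ ≠ 0 := norm_ne_zero_iff.mpr hz
  rw [← h0] at h1
  simp only [inner_zero_right, inner_smul_right, real_inner_self_eq_norm_sq] at h1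
  rw [div_mul_cancel₀ _ (pow_ne_zero 2 hz'), mul_comm, Complex.exp_pi_mul_I] at h1
  norm_num at h1

/-- The row space of a matrix, parametrized by its left multiplication. -/
def rowMap (S : Matrix (Fin r) (Fin n) ℝ) : E r →ₗ[ℝ] E n := applyMatLM Sᵀ

theorem inner_rowMap (S : Matrix (Fin r) (Fin n) ℝ) (z : E r) (x : E n) :
    inner ℝ (rowMap S z) x = inner ℝ z (applyMat S x) := by
  change x.ofLp ⬝ᵥ (Sᵀ *ᵥ z.ofLp) = (S *ᵥ x.ofLp) ⬝ᵥ z.ofLp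
  rw [Matrix.mulVec_transpose, dotProduct_comm, ← Matrix.dotProduct_mulVec, dotProduct_comm]

theorem injective_rowMap {S : Matrix (Fin r) (Fin n) ℝ} (hS : S.rank = r) :
    Function.Injective (rowMap S) := by
  rw [← LinearMap.ker_eq_bot, LinearMap.ker_eq_bot']
  intro z hz
  obtain ⟨x, hx⟩ := surjective_applyMatLM hS z
  have h := inner_rowMap S z x
  rw [hz, inner_zero_left, show applyMat S x = z from hx] at h
  exact inner_self_eq_zero.mp h.symm

/-! ### From the cone to waves, and from solutions to the cone. -/

theorem isWaveSolution_of_mem_obstructionCone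
    {A : Matrix (Fin l) (Fin k) (MvPolynomial (Fin n) ℂ)} (hA : ∀ i j, (A i j).IsHomogeneous d)
    {u : Fin k → ℂ} (hu : u ∈ obstructionCone A r) {S : Matrix (Fin r) (Fin n) ℝ}
    (hS : S.rank = r) : ∃ δ : E r → ℂ, BoundedNonconstant δ ∧
      IsWaveSolution A (waveOfFun (fun x => δ (applyMat S x)) u) := by
  have hfin : Module.finrank ℝ (LinearMap.range (rowMap S)) = r := by
    rw [LinearMap.finrank_range_of_inj (injective_rowMap hS), finrank_euclideanSpace_fin]
  have h := Set.mem_iInter₂.mp hu _ hfin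
  obtain ⟨_, ⟨⟨z, rfl⟩, hz0⟩, hz⟩ := Set.mem_iUnion₂.mp h |>.imp fun y ⟨hy, hyu⟩ =>
    (⟨hy, hyu⟩ : _ ∧ _)
  have hz1 : z ≠ 0 := by
    rintro rfl
    exact hz0 (map_zero _)
  refine ⟨fun w => Complex.exp (Complex.I * ((inner ℝ z w : ℝ) : ℂ)),
    ⟨memLp_top_exp_inner z, not_ae_const_exp_inner hz1⟩, u, ℝ ∙ rowMap S z, ?_, ?_⟩
  · intro ξ hξ
    obtain ⟨t, rfl⟩ := Submodule.mem_span_singleton.mp hξ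
    ext i
    have hzi := congrFun hz i
    rw [symbol_mulVec_apply] at hzi ⊢
    have e : ∀ j, MvPolynomial.eval (fun i => (((t • rowMap S z) i : ℝ) : ℂ)) (A i j) =
        (t : ℂ) ^ d * MvPolynomial.eval (fun i => ((rowMap S z i : ℝ) : ℂ)) (A i j) := by
      intro j
      rw [← eval_smul_of_isHomogeneous (hA i j)]
      simp
    simp only [e, mul_assoc, ← Finset.mul_sum]
    rw [hzi]
    simp
  · refine subset_closure (Submodule.subset_span ⟨rowMap S z, Submodule.mem_span_singleton_self _, ?_⟩)
    simp only [simpleWave, inner_rowMap]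

/-- As `g` need not be differentiable, the derivative is put on the test function: the convolution
of `g` with the reflection of `f` is constant along `v`, and its `v`-derivative at `0` is the
pairing of `∂_{v} (ofFun g)` with `f`. -/
theorem lineDeriv_ofFun_eq_zero {g : E n → ℂ} (hg : LocallyIntegrable g volume) {v : E n}
    (hv : ∀ (t : ℝ) (x : E n), g (x + t • v) = g x) : ∂_{v} (ofFun g) = 0 := by
  ext f
  let f' : E n → ℝ := fun x => f (-x)
  have hf1 : ContDiff ℝ 1 f := f.contDiff.of_le (by simp)
  have hf' : ContDiff ℝ 1 f' := hf1.comp contDiff_neg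
  have hc' : HasCompactSupport f' := f.hasCompactSupport.comp_homeomorph (Homeomorph.neg (E n))
  let B : ℂ →L[ℝ] ℝ →L[ℝ] ℂ := (ContinuousLinearMap.lsmul ℝ ℝ).flip
  have hconv : ∀ s : ℝ, (g ⋆[B, volume] f') (s • v) = (g ⋆[B, volume] f') 0 := by
    intro s
    change ∫ t, f (-(s • v - t)) • g t = ∫ t, f (-(0 - t)) • g t
    rw [← integral_add_right_eq_self (fun t => f (-(s • v - t)) • g t) (s • v)]
    refine integral_congr_ae (ae_of_all _ fun t => ?_)
    simp [hv]
  have hd := hc'.hasFDerivAt_convolution_right B hg hf' (0 : E n)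
  have hline := hd.hasLineDerivAt v
  rw [HasLineDerivAt] at hline
  simp only [zero_add, hconv] at hline
  have h0 := hline.unique (hasDerivAt_const _ _)
  rw [convolution_precompR_apply B hg (hc'.fderiv ℝ) (hf'.continuous_fderiv one_ne_zero)] at h0
  rw [Distribution.lineDerivOp_apply_apply, ofFun_apply hg]
  refine Eq.trans ?_ h0
  change _ = ∫ t, (fderiv ℝ f' (0 - t) v) • g t
  refine integral_congr_ae (ae_of_all _ fun t => ?_)
  have hfd : HasFDerivAt f' ((fderiv ℝ f t).comp (-ContinuousLinearMap.id ℝ (E n))) (-t) := by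
    have h1 : HasFDerivAt f (fderiv ℝ f t) (-(-t)) := by
      rw [neg_neg]
      exact ((hf1.differentiable one_ne_zero) t).hasFDerivAt
    exact h1.comp (-t) (hasFDerivAt_id _).neg
  simp only [zero_sub, hfd.fderiv]
  congr 1
  change -((TestFunction.lineDerivCLM ℝ v f) t) = _
  rw [TestFunction.lineDerivCLM_eq_fderivCLM, TestFunction.fderivCLM_apply_of_le _ (by simp)]
  simp

theorem mem_obstructionCone_of_isSolution
    {A : Matrix (Fin l) (Fin k) (MvPolynomial (Fin n) ℂ)} (hA : ∀ i j, (A i j).IsHomogeneous d)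
    {u : Fin k → ℂ} (h : ∀ S : Matrix (Fin r) (Fin n) ℝ, S.rank = r →
      ∃ δ : E r → ℂ, BoundedNonconstant δ ∧
        IsSolution A (waveOfFun (fun x => δ (applyMat S x)) u)) :
    u ∈ obstructionCone A r := by
  refine Set.mem_iInter₂.mpr fun σ hσ => ?_
  by_contra hcon
  let b : OrthonormalBasis (Fin r) ℝ σ := (stdOrthonormalBasis ℝ σ).reindex (finCongr hσ)
  let S : Matrix (Fin r) (Fin n) ℝ := Matrix.of fun i => ((b i : E n)).ofLp
  have hSx : ∀ (x : E n) (i : Fin r), applyMat S x i = inner ℝ (b i : E n) x := by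
    intro x i
    change (b i : E n).ofLp ⬝ᵥ x.ofLp = x.ofLp ⬝ᵥ (b i : E n).ofLp
    exact dotProduct_comm _ _
  have hS : S.rank = r := by
    have hli : LinearIndependent ℝ fun i => (b i : E n) :=
      by
      have := b.toBasis.linearIndependent.map' σ.subtype σ.ker_subtype
      simpa [Function.comp_def] using this
    have := (hli.map' (WithLp.linearEquiv 2 ℝ (Fin n → ℝ)).toLinearMap
      (LinearEquiv.ker _))
    have h2 : LinearIndependent ℝ S.row := this
    simpa using h2.rank_matrix
  obtain ⟨δ, ⟨hδ, hnc⟩, hsol⟩ := h S hS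
  have hg := memLp_top_comp_applyMat hδ hS
  let b' := stdOrthonormalBasis ℝ σᗮ
  -- The left family tests `A(ξ)u = 0` and the right one tests `ξ ∈ σ`; by `hcon` only `ξ = 0`
  -- passes both.
  let q : Fin l ⊕ Fin (Module.finrank ℝ σᗮ) → E n → ℂ :=
    Sum.elim (fun i ξ => (2 * Real.pi * Complex.I) ^ d * (symbol A ξ *ᵥ u) i)
      fun i ξ => 2 * Real.pi * Complex.I * ((inner ℝ ξ (b' i : E n) : ℝ) : ℂ)
  have hinner : ∀ v : E n, (fun ξ : E n => ((inner ℝ ξ v : ℝ) : ℂ)).HasTemperateGrowth := by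
    intro v
    fun_prop
  have hq : ∀ i, (q i).HasTemperateGrowth := by
    rintro (i | i)
    · exact hasTemperateGrowth_scaled_symbol hA u i
    · exact (Function.HasTemperateGrowth.const _).mul (hinner _)
  have hpi : (2 * Real.pi * Complex.I : ℂ) ≠ 0 := by simp [Real.pi_ne_zero]
  have hq0 : ∀ ξ, (∀ i, q i ξ = 0) → ξ = 0 := by
    intro ξ hξ
    by_contra hne
    refine hcon (Set.mem_iUnion₂.mpr ⟨ξ, ⟨?_, hne⟩, ?_⟩)
    · rw [SetLike.mem_coe, ← Submodule.orthogonal_orthogonal σ, Submodule.mem_orthogonal']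
      intro w hw
      have hb : ∀ i, inner ℝ ξ (b' i : E n) = 0 := by
        intro i
        have := hξ (Sum.inr i)
        simpa [q, Real.pi_ne_zero] using this
      have e := congrArg (fun w : σᗮ => (w : E n)) (b'.sum_repr ⟨w, hw⟩)
      simp only [Submodule.coe_sum, Submodule.coe_smul] at e
      rw [← e, inner_sum]
      exact Finset.sum_eq_zero fun i _ => by rw [inner_smul_right, hb i, mul_zero]
    · ext i
      have := hξ (Sum.inl i)
      simpa [q, hpi, Real.pi_ne_zero] using this
  refine hnc ((ae_const_of_annihilated hg hq hq0 ?_).imp fun c hc =>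
    ae_const_of_comp_applyMat hδ.1 hS hc)
  rintro L hL (i | i)
  · have := hL.system hA u i
    rwa [hsol i] at this
  -- `S` annihilates `σᗮ`, so `δ ∘ S` does not change along it.
  · have h0 : ∂_{(b' i : E n)} (ofFun fun x => δ (applyMat S x)) = 0 := by
      refine lineDeriv_ofFun_eq_zero (hg.locallyIntegrable le_top) fun t x => ?_
      congr 1
      ext j
      rw [hSx, hSx, inner_add_right, inner_smul_right,
        Submodule.mem_orthogonal _ _ |>.mp (b' i).2 _ (b j).2]
      simp
    have := hL.lineDeriv (b' i : E n)
    rw [h0, TemperedDistribution.lineDeriv_eq_fourierMultiplierCLM] at this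
    exact this.multiplier_const_mul (hinner _)

end WavePDE

end

theorem mainTheorem4 {n k l d r : ℕ} (hr : 1 ≤ r) (hrn : r ≤ n)
    (A : Matrix (Fin l) (Fin k) (MvPolynomial (Fin n) ℂ))
    (hA : ∀ i j, (A i j).IsHomogeneous d) (u : Fin k → ℂ) :
    List.TFAE [
      u ∈ WavePDE.obstructionCone A r,
      ∀ S : Matrix (Fin r) (Fin n) ℝ, S.rank = r →
        ∃ δ : WavePDE.E r → ℂ, WavePDE.BoundedNonconstant δ ∧
          WavePDE.IsWaveSolution A (WavePDE.waveOfFun (fun x => δ (WavePDE.applyMat S x)) u),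
      ∀ S : Matrix (Fin r) (Fin n) ℝ, S.rank = r →
        ∃ δ : WavePDE.E r → ℂ, WavePDE.BoundedNonconstant δ ∧
          WavePDE.IsSolution A (WavePDE.waveOfFun (fun x => δ (WavePDE.applyMat S x)) u)] := by
  tfae_have 1 → 2 := fun h S hS => WavePDE.isWaveSolution_of_mem_obstructionCone hA h hS
  tfae_have 2 → 3 := fun h S hS => (h S hS).imp fun δ hδ => ⟨hδ.1, hδ.2.isSolution hA⟩
  tfae_have 3 → 1 := WavePDE.mem_obstructionCone_of_isSolution hA
  tfae_finish
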